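/- Let $M$ be a monoid with identity $1$. Elements $x,y\in M$ are $\mathcal J$-related if $MxM=MyM$ and $\mathcal R$-related if $xM=yM$. The monoid $M$ is (left) sofic if for every finite $K\subseteq M$ and every $\varepsilon>0$ there are a finite non-empty set $X$ and a map $M\times X\to X$, $(m,x)\mapsto m\cdot x$, such that $1\cdot x=x$ for all $x\in X$; for all $g,h\in K$ the proportion of $x\in X$ with $g\cdot(h\cdot x)=(gh)\cdot x$ is at least $1-\varepsilon$; and for all $g\ne h$ in $K$ the proportion of $x\in X$ with $g\cdot x=h\cdot x$ is at most $\varepsilon$. A group $G$ is sofic if for every finite $K\subseteq G$ and every $\varepsilon>0$ there are a finite non-empty set $X$ and a map $\varphi:G\to\mathrm{Sym}(X)$ such that, for the normalized Hamming distance $d(\sigma,\tau)=|\{x\in X:\sigma(x)\ne\tau(x)\}|/|X|$, we have $d(\varphi(gh),\varphi(g)\varphi(h))\le\varepsilon$ for all $g,h\in K$ and $d(\varphi(g),\varphi(h))\ge1-\varepsilon$ for all $g\neq h$ in $K$. A group $G$ is amenable if there is a finitely additive probability measure on the set of all subsets of $G$ that is invariant under left translation. **Corollary.** Let $M$ be a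 monoid such that the $\mathcal J$-class of the identity is a sofic group $G$ (under the multiplication of $M$). If at least one of the following conditions holds, then $M$ is sofic: (i) $G$ is amenable; (ii) $M\setminus G$ is finite; (iii) for every $x\in M\setminus G$, the $\mathcal R$-class of $x$ is finite. -/

import Mathlib

namespace SoficMonoids

/-- The proportion of the elements of a (finite, non-empty) set `X` that satisfy `p`. -/
noncomputable def proportion {X : Type*} (p : X → Prop) : ℝ :=
  (Nat.card {x : X // p x} : ℝ) / (Nat.card X : ℝ)

/-- A map `M × X → X` (written `act m x`) is a left `(K, ε)`-action of the monoid `M`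
on the set `X`. -/
structure IsAlmostAction {M X : Type*} [Monoid M] (K : Finset M) (ε : ℝ)
    (act : M → X → X) : Prop where
  one_act : ∀ x : X, act 1 x = x
  mul_act : ∀ g ∈ K, ∀ h ∈ K,
    1 - ε ≤ proportion (fun x : X => act g (act h x) = act (g * h) x)
  separates : ∀ g ∈ K, ∀ h ∈ K, g ≠ h → proportion (fun x : X => act g x = act h x) ≤ ε

/-- (Left) sofic monoids. -/
def IsSofic (M : Type*) [Monoid M] : Prop :=
  ∀ (K : Finset M) (ε : ℝ), 0 < ε →
    ∃ (X : Type) (_ : Finite X) (_ : Nonempty X) (act : M → X → X), IsAlmostAction K ε act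

/-- Sofic groups, in the usual sense: a finite part of the group can be approximated by
permutations of a finite non-empty set, with respect to the normalized Hamming distance
`d(σ, τ) = |{x | σ x ≠ τ x}| / |X|`. -/
def IsSoficGroup (G : Type*) [Group G] : Prop :=
  ∀ (K : Finset G) (ε : ℝ), 0 < ε →
    ∃ (X : Type) (_ : Finite X) (_ : Nonempty X) (φ : G → Equiv.Perm X),
      (∀ g ∈ K, ∀ h ∈ K, proportion (fun x : X => φ (g * h) x ≠ (φ g * φ h) x) ≤ ε) ∧
      (∀ g ∈ K, ∀ h ∈ K, g ≠ h → 1 - ε ≤ proportion (fun x : X => φ g x ≠ φ h x))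

/-- A group is amenable if it admits a finitely additive probability measure, defined on all
subsets, that is invariant under left translation. -/
def IsAmenable (G : Type*) [Group G] : Prop :=
  ∃ μ : Set G → ℝ,
    (∀ A, 0 ≤ μ A) ∧
    μ Set.univ = 1 ∧
    (∀ A B, Disjoint A B → μ (A ∪ B) = μ A + μ B) ∧
    (∀ (g : G) (A : Set G), μ ((fun x => g * x) '' A) = μ A)

/-- Green's relation `ℛ`: `x` and `y` generate the same principal right ideal, `xM = yM`. -/
def GreenR {M : Type*} [Monoid M] (x y : M) : Prop :=
  {z : M | ∃ a : M, z = x * a} = {z : M | ∃ a : M, z = y * a}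

/-- Green's relation `𝒥`: `x` and `y` generate the same principal two-sided ideal,
`MxM = MyM`. -/
def GreenJ {M : Type*} [Monoid M] (x y : M) : Prop :=
  {z : M | ∃ a b : M, z = a * x * b} = {z : M | ∃ a b : M, z = a * y * b}

end SoficMonoids

namespace SoficMonoids

/-! Elements outside `G` form an ideal, so a finite approximation `A` of `G` can be extended to `M`
by adjoining a finite set `Y ⊆ M`: a non-unit `m` sends `a` to `m * ι (l a)`, where `l a` is a label
in `G`, and acts on `Y` by multiplication. Taking many copies of `A` makes `Y` negligible. The only
new constraint is that `t * ι (l (g a)) = t * ι g * ι (l a)` for most `a`, for non-units `t`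
(`isSofic_of_isLabelledApprox`). If `G` is amenable, a Følner set labelled by itself works. Under
the other two conditions each orbit `tG` is finite, so labels matter only through a finite quotient
of `G`, and a sofic approximation times that quotient works. -/

/-! ### Proportions in finite sets. -/

theorem proportion_mono {X : Type*} [Finite X] {p q : X → Prop} (h : ∀ x, p x → q x) :
    proportion p ≤ proportion q := by
  unfold proportion
  gcongr
  exact_mod_cast Set.ncard_le_ncard (s := {x | p x}) (t := {x | q x}) h (Set.toFinite _)

theorem proportion_or_le {X : Type*} [Finite X] (p q : X → Prop) :
    proportion (fun x => p x ∨ q x) ≤ proportion p + proportion q := by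
  unfold proportion
  rw [← add_div]
  gcongr
  exact_mod_cast Set.ncard_union_le {x | p x} {x | q x}

theorem proportion_false (X : Type*) : proportion (fun _ : X => False) = 0 := by
  simp [proportion]

theorem proportion_not {X : Type*} [Finite X] [Nonempty X] (p : X → Prop) :
    proportion (fun x => ¬ p x) = 1 - proportion p := by
  have hX : (Nat.card X : ℝ) ≠ 0 := by exact_mod_cast Nat.card_pos.ne'
  have h : ({x | p x}.ncard : ℝ) + ({x | p x}ᶜ.ncard : ℝ) = Nat.card X := by
    exact_mod_cast Set.ncard_add_ncard_compl {x | p x}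
  unfold proportion
  rw [eq_sub_iff_add_eq, ← add_div, div_eq_one_iff_eq hX, ← h, add_comm]
  rfl

theorem proportion_equiv {X Y : Type*} (e : X ≃ Y) (p : Y → Prop) :
    proportion (fun x => p (e x)) = proportion p := by
  unfold proportion
  rw [Nat.card_congr e, Nat.card_congr (e.subtypeEquiv (q := p) fun _ => Iff.rfl)]

theorem proportion_fst {X Y : Type*} [Finite Y] [Nonempty Y] (p : X → Prop) :
    proportion (fun z : X × Y => p z.1) = proportion p := by
  have hY : (Nat.card Y : ℝ) ≠ 0 := by exact_mod_cast Nat.card_pos.ne'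
  have e : {z : X × Y // p z.1} ≃ {x // p x} × Y :=
    { toFun := fun z => (⟨z.1.1, z.2⟩, z.1.2)
      invFun := fun z => ⟨(z.1.1, z.2), z.1.2⟩
      left_inv := fun _ => rfl
      right_inv := fun _ => rfl }
  unfold proportion
  rw [Nat.card_congr e, Nat.card_prod, Nat.card_prod]
  push_cast
  rw [mul_div_mul_right _ _ hY]

theorem proportion_sum_le {X Y : Type*} [Finite X] [Nonempty X] [Finite Y] (p : X ⊕ Y → Prop) :
    proportion p ≤ proportion (fun x => p (.inl x)) + (Nat.card Y : ℝ) / Nat.card X := by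
  have hX : (0 : ℝ) < Nat.card X := by exact_mod_cast Nat.card_pos
  unfold proportion
  rw [Nat.card_congr (Equiv.subtypeSum (p := p)), Nat.card_sum, Nat.card_sum, ← add_div]
  push_cast
  have hle : (Nat.card {y : Y // p (.inr y)} : ℝ) ≤ Nat.card Y := by
    exact_mod_cast Finite.card_subtype_le _
  gcongr
  linarith [(Nat.card Y).cast_nonneg (α := ℝ)]

/-- The universe of the space of an almost action is immaterial. -/
theorem IsAlmostAction.exists_type {M X : Type*} [Monoid M] [Finite X] [Nonempty X] {K : Finset M}
    {ε : ℝ} {act : M → X → X} (h : IsAlmostAction K ε act) :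
    ∃ (Z : Type) (_ : Finite Z) (_ : Nonempty Z) (act' : M → Z → Z), IsAlmostAction K ε act' := by
  obtain ⟨n, ⟨e⟩⟩ := Finite.exists_equiv_fin X
  refine ⟨Fin n, inferInstance, e.nonempty_congr.1 inferInstance,
    fun m z => e (act m (e.symm z)), ⟨?_, ?_, ?_⟩⟩
  · simp [h.one_act]
  · intro a ha b hb
    rw [← proportion_equiv e]
    simpa using h.mul_act a ha b hb
  · intro a ha b hb hab
    rw [← proportion_equiv e]
    simpa using h.separates a ha b hb hab

/-! ### From labelled approximations of the group to the monoid. -/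

/-- A finite approximation of the group `G`, labelled by elements of `G` in such a way that, after
left multiplication by an element of `T`, the labelling is almost equivariant. -/
structure IsLabelledApprox {M G A : Type*} [Monoid M] [Group G] (ι : G →* M) (K : Finset G)
    (T : Finset M) (ε : ℝ) (φ : G → A → A) (l : A → G) : Prop where
  one : ∀ a, φ 1 a = a
  mul : ∀ g ∈ K, ∀ k ∈ K, proportion (fun a => φ g (φ k a) ≠ φ (g * k) a) ≤ ε
  separates : ∀ g ∈ K, ∀ k ∈ K, g ≠ k → proportion (fun a => φ g a = φ k a) ≤ ε
  label : ∀ g ∈ K, ∀ t ∈ T, proportion (fun a => t * ι (l (φ g a)) ≠ t * ι g * ι (l a)) ≤ ε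

section Extension

variable {M G A : Type*} [Monoid M] [Group G]

open Classical in
/-- The action on `A × B ⊔ Y` in which the units act on the first summand through `φ`, and
everything else is left multiplication in `M`, truncated to the finite set `Y`. -/
noncomputable def extendedAct {B : Type*} (ι : G →* M) (φ : G → A → A) (l : A → G) (Y : Finset M)
    (m : M) : (A × B) ⊕ Y → (A × B) ⊕ Y
  | .inl x =>
    if hm : ∃ g, ι g = m then .inl (φ hm.choose x.1, x.2)
    else if hy : m * ι (l x.1) ∈ Y then .inr ⟨m * ι (l x.1), hy⟩ else .inl x
  | .inr y => if hy : m * y ∈ Y then .inr ⟨m * y, hy⟩ else .inr y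

variable {B : Type*} {ι : G →* M} {φ : G → A → A} {l : A → G} {Y : Finset M}

theorem extendedAct_unit (hι : Function.Injective ι) (g : G) (x : A × B) :
    extendedAct ι φ l Y (ι g) (.inl x) = .inl (φ g x.1, x.2) := by
  have hm : ∃ k, ι k = ι g := ⟨g, rfl⟩
  have : hm.choose = g := hι hm.choose_spec
  simp only [extendedAct]
  rw [dif_pos hm, this]

theorem extendedAct_nonunit {m : M} (hm : m ∉ Set.range ι) (x : A × B) (hy : m * ι (l x.1) ∈ Y) :
    extendedAct ι φ l Y m (.inl x) = .inr ⟨m * ι (l x.1), hy⟩ := by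
  simp only [extendedAct]
  rw [dif_neg (show ¬∃ g, ι g = m from hm), dif_pos hy]

theorem extendedAct_inr {m : M} (y : Y) (hy : m * y ∈ Y) :
    extendedAct (B := B) ι φ l Y m (.inr y) = .inr ⟨m * y, hy⟩ := by
  simp only [extendedAct]
  rw [dif_pos hy]

end Extension

theorem isSofic_of_isLabelledApprox {M : Type*} [Monoid M] {G : Type*} [Group G]
    (ι : G →* M) (hι : Function.Injective ι)
    (hideal : ∀ a b : M, a * b ∈ Set.range ι → a ∈ Set.range ι ∧ b ∈ Set.range ι)
    (H : ∀ (K : Finset G) (T : Finset M) (ε : ℝ), 0 < ε → (∀ t ∈ T, t ∉ Set.range ι) →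
      ∃ (A : Type*) (_ : Finite A) (_ : Nonempty A) (φ : G → A → A) (l : A → G),
        IsLabelledApprox ι K T ε φ l) :
    IsSofic M := by
  classical
  intro K ε hε
  obtain ⟨A, _, _, φ, l, hA⟩ := H (K.preimage ι hι.injOn) {m ∈ K | m ∉ Set.range ι} (ε / 2)
    (half_pos hε) (by simp +contextual)
  have := Fintype.ofFinite A
  -- Large enough that no truncation occurs when elements of `K`, or products of two of them, are
  -- applied to the first summand.
  let Y : Finset M := ((K ∪ (K ×ˢ K).image fun p => p.1 * p.2) ×ˢ (Finset.univ : Finset A)).image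
    fun p => p.1 * ι (l p.2)
  have hY₁ : ∀ m ∈ K, ∀ a, m * ι (l a) ∈ Y := fun m hm a =>
    Finset.mem_image.2 ⟨(m, a), by simp [hm], rfl⟩
  have hY₂ : ∀ m ∈ K, ∀ k ∈ K, ∀ a, m * k * ι (l a) ∈ Y := fun m hm k hk a =>
    Finset.mem_image.2 ⟨(m * k, a), by
      simp only [Finset.mem_product, Finset.mem_union, Finset.mem_image, Finset.mem_univ, and_true]
      exact Or.inr ⟨(m, k), ⟨hm, hk⟩, rfl⟩, rfl⟩
  obtain ⟨n, hn⟩ := exists_nat_gt ((Nat.card Y : ℝ) / (ε / 2))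
  have hn0 : (0 : ℝ) < n := lt_of_le_of_lt (by positivity) hn
  have : NeZero n := ⟨by rintro rfl; simp at hn0⟩
  have hcard : (Nat.card Y : ℝ) / Nat.card (A × Fin n) ≤ ε / 2 := by
    have hA1 : (1 : ℝ) ≤ Nat.card A := by exact_mod_cast Nat.card_pos
    rw [Nat.card_prod, Nat.card_fin, div_le_iff₀ (by push_cast; positivity)]
    rw [div_lt_iff₀ (by positivity)] at hn
    push_cast
    nlinarith [mul_pos hn0 (half_pos hε)]
  let X := (A × Fin n) ⊕ Y
  have key : ∀ (p : X → Prop) (q : A → Prop), proportion q ≤ ε / 2 →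
      (∀ x, p (.inl x) → q x.1) → proportion p ≤ ε := fun p q hq hpq => by
    have h₁ := proportion_sum_le p
    have h₂ := proportion_mono hpq
    rw [proportion_fst] at h₂
    linarith
  have hfalse : proportion (fun _ : A => False) ≤ ε / 2 := by
    rw [proportion_false]; positivity
  refine IsAlmostAction.exists_type (X := X) (act := extendedAct ι φ l Y) ⟨?_, ?_, ?_⟩
  · rintro (x | y)
    · rw [← map_one ι, extendedAct_unit hι, hA.one]
    · rw [extendedAct_inr _ (by simp)]
      simp
  · intro a ha b hb
    rw [sub_le_comm, ← proportion_not]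
    by_cases hb' : b ∈ Set.range ι
    · obtain ⟨k, rfl⟩ := hb'
      by_cases ha' : a ∈ Set.range ι
      · obtain ⟨g, rfl⟩ := ha'
        refine key _ _ (hA.mul g (by simpa using ha) k (by simpa using hb)) fun x hx => ?_
        contrapose! hx
        rw [extendedAct_unit hι, extendedAct_unit hι, ← map_mul, extendedAct_unit hι, hx]
      -- A non-unit after a unit: the only case that needs the labels to be almost equivariant.
      · refine key _ _ (hA.label k (by simpa using hb) a (by simpa [ha] using ha')) fun x hx => ?_
        contrapose! hx
        rw [extendedAct_unit hι, extendedAct_nonunit ha' _ (hY₁ a ha _),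
          extendedAct_nonunit (fun h => ha' (hideal _ _ h).1) _ (hY₂ a ha _ hb _)]
        simp only [hx]
    · refine key _ _ hfalse fun x hx => hx ?_
      rw [extendedAct_nonunit hb' _ (hY₁ b hb _), extendedAct_inr _ (by
          simpa only [mul_assoc] using hY₂ a ha b hb x.1),
        extendedAct_nonunit (fun h => hb' (hideal _ _ h).2) _ (hY₂ a ha _ hb _)]
      simp only [mul_assoc]
  · intro a ha b hb hab
    by_cases ha' : a ∈ Set.range ι <;> by_cases hb' : b ∈ Set.range ι
    · obtain ⟨g, rfl⟩ := ha'
      obtain ⟨k, rfl⟩ := hb'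
      refine key _ _ (hA.separates g (by simpa using ha) k (by simpa using hb)
        fun h => hab (h ▸ rfl)) fun x hx => ?_
      rw [extendedAct_unit hι, extendedAct_unit hι] at hx
      exact congrArg Prod.fst (Sum.inl.inj hx)
    · obtain ⟨g, rfl⟩ := ha'
      refine key _ _ hfalse fun x hx => ?_
      rw [extendedAct_unit hι, extendedAct_nonunit hb' _ (hY₁ b hb _)] at hx
      cases hx
    · obtain ⟨k, rfl⟩ := hb'
      refine key _ _ hfalse fun x hx => ?_
      rw [extendedAct_unit hι, extendedAct_nonunit ha' _ (hY₁ a ha _)] at hx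
      cases hx
    · refine key _ _ hfalse fun x hx => hab ?_
      rw [extendedAct_nonunit ha' _ (hY₁ a ha _), extendedAct_nonunit hb' _ (hY₁ b hb _)] at hx
      -- Labels are invertible, so they cancel on the right.
      have h := congrArg Subtype.val (Sum.inr.inj hx)
      simpa [mul_assoc, ← map_mul] using congrArg (· * ι (l x.1)⁻¹) h

/-! ### Labelled approximations from finite orbits. -/

/-- In a sofic approximation of a group, the identity may be taken to act trivially. -/
theorem IsSoficGroup.exists_one_act {G : Type*} [Group G] (hG : IsSoficGroup G) (K : Finset G)
    {ε : ℝ} (hε : 0 < ε) :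
    ∃ (X : Type) (_ : Finite X) (_ : Nonempty X) (σ : G → X → X), (∀ x, σ 1 x = x) ∧
      (∀ g ∈ K, ∀ k ∈ K, proportion (fun x => σ g (σ k x) ≠ σ (g * k) x) ≤ ε) ∧
      (∀ g ∈ K, ∀ k ∈ K, g ≠ k → proportion (fun x => σ g x = σ k x) ≤ ε) := by
  classical
  obtain ⟨X, _, _, φ, hmul, hsep⟩ := hG (insert 1 K) (ε / 2) (half_pos hε)
  -- Where `φ 1 (φ 1 x) = φ 1 x`, injectivity gives `φ 1 x = x`.
  have h1 : proportion (fun x => φ 1 x ≠ x) ≤ ε / 2 := by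
    refine (proportion_mono fun x hx h => hx ?_).trans (hmul 1 (by simp) 1 (by simp))
    rw [mul_one, Equiv.Perm.mul_apply] at h
    exact ((φ 1).injective h).symm
  have key : ∀ p q : X → Prop, proportion q ≤ ε / 2 → (∀ x, φ 1 x = x → p x → q x) →
      proportion p ≤ ε := fun p q hq hpq => by
    have h₁ := proportion_or_le q (fun x => φ 1 x ≠ x)
    have h₂ : proportion p ≤ proportion (fun x => q x ∨ φ 1 x ≠ x) := proportion_mono fun x hx => by
      by_cases h : φ 1 x = x
      · exact Or.inl (hpq x h hx)
      · exact Or.inr h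
    linarith
  let σ : G → X → X := fun g => if g = 1 then id else φ g
  have hσ1 : σ 1 = id := if_pos rfl
  have hσ : ∀ g x, φ 1 x = x → σ g x = φ g x := fun g x hx => by
    by_cases h : g = 1
    · subst h; rw [hσ1, hx]; rfl
    · simp only [σ, if_neg h]
  refine ⟨X, inferInstance, inferInstance, σ, fun x => congrFun hσ1 x, ?_, ?_⟩
  · intro g hg k hk
    refine key _ _ (hmul g (by simp [hg]) k (by simp [hk])) fun x hx h h' => h ?_
    rw [hσ _ _ hx, hσ _ _ hx]
    by_cases hg1 : g = 1
    · rw [hg1, hσ1, one_mul]; rfl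
    · simp only [σ, if_neg hg1]
      rw [h', Equiv.Perm.mul_apply]
  · intro g hg k hk hgk
    have := hsep g (by simp [hg]) k (by simp [hk]) hgk
    refine key _ (fun x => φ g x = φ k x) ?_ fun x hx h => ?_
    · rw [proportion_not (fun x => φ g x = φ k x)] at this
      linarith
    · rwa [hσ _ _ hx, hσ _ _ hx] at h

theorem exists_isLabelledApprox_of_finite_orbits.{u, v} {M : Type u} [Monoid M] {G : Type v} [Group G]
    (ι : G →* M) (hG : IsSoficGroup G) (K : Finset G) (T : Finset M) {ε : ℝ} (hε : 0 < ε)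
    (hT : ∀ t ∈ T, (Set.range fun g => t * ι g).Finite) :
    ∃ (A : Type u) (_ : Finite A) (_ : Nonempty A) (φ : G → A → A) (l : A → G),
      IsLabelledApprox ι K T ε φ l := by
  obtain ⟨X, _, _, σ, hone, hmul, hsep⟩ := IsSoficGroup.exists_one_act hG K hε
  let U : Set M := ⋃ t ∈ T, Set.range fun g => t * ι g
  have hU : U.Finite := T.finite_toSet.biUnion hT
  have : Finite U := hU
  have hUmul : ∀ (u : U) (g : G), u.1 * ι g ∈ U := by
    rintro ⟨u, hu⟩ g
    simp only [U, Set.mem_iUnion] at hu ⊢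
    obtain ⟨t, ht, k, rfl⟩ := hu
    exact ⟨t, ht, k * g, by simp [mul_assoc]⟩
  have hTU : ∀ t ∈ T, t ∈ U := fun t ht => by
    simp only [U, Set.mem_iUnion]
    exact ⟨t, ht, 1, by simp⟩
  -- Right translation on the finite set `U = TG` has finite image. Replacing a group element by the
  -- representative `s` of its class does not change products `u * ι g`, so the label condition
  -- holds exactly.
  let ρ : G → U → U := fun g u => ⟨u.1 * ι g, hUmul u g⟩
  let s : Set.range ρ → G := fun q => q.2.choose
  have hs : ∀ q, ρ (s q) = q.1 := fun q => q.2.choose_spec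
  let r : G → Set.range ρ := fun g => ⟨ρ g, g, rfl⟩
  have hr : ∀ (u : U) (g : G), u.1 * ι (s (r g)) = u.1 * ι g := fun u g =>
    congrArg Subtype.val (congrFun (hs (r g)) u)
  have : Nonempty (Set.range ρ) := ⟨r 1⟩
  refine ⟨X × Set.range ρ, inferInstance, inferInstance,
    fun g a => (σ g a.1, r (g * s a.2)), fun a => s a.2, ⟨?_, ?_, ?_, ?_⟩⟩
  · rintro ⟨x, q⟩
    refine Prod.ext (hone x) (Subtype.ext ?_)
    simp only [r, one_mul, hs]
  · intro g hg k hk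
    refine le_trans (le_of_le_of_eq ?_ (proportion_fst (Y := Set.range ρ) _)) (hmul g hg k hk)
    refine proportion_mono fun a ha h => ha (Prod.ext h (Subtype.ext (funext fun u => ?_)))
    refine Subtype.ext ?_
    have := hr ⟨_, hUmul u g⟩ (k * s a.2)
    simpa [r, ρ, mul_assoc] using this
  · intro g hg k hk hgk
    refine le_trans (le_of_le_of_eq ?_ (proportion_fst (Y := Set.range ρ) _)) (hsep g hg k hk hgk)
    exact proportion_mono fun a ha => congrArg Prod.fst ha
  · intro g hg t ht
    refine (proportion_mono fun a ha => ha ?_).trans ((proportion_false _).trans_le hε.le)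
    simpa [mul_assoc] using hr ⟨t, hTU t ht⟩ (g * s a.2)

/-! ### Amenability and Følner sets. -/

section Foelner

open scoped Pointwise

variable {G : Type*} [Group G]

/-- Otherwise Hall's marriage theorem yields an injection `f : G × Bool → G` with `f (x, b) ∈ K *
{x}`, a paradoxical decomposition giving `G` mass at least 2. -/
theorem IsAmenable.not_doubling [DecidableEq G] (hG : IsAmenable G) (K : Finset G) :
    ∃ F : Finset G, (K * F).card < 2 * F.card := by
  by_contra! hK
  obtain ⟨μ, hpos, huniv, hadd, hinv⟩ := hG
  have hempty : μ ∅ = 0 := by simpa using hadd ∅ ∅ (by simp)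
  have hsum : ∀ {J : Type _} (s : Finset J) (S : J → Set G),
      (s : Set J).PairwiseDisjoint S → μ (⋃ j ∈ s, S j) = ∑ j ∈ s, μ (S j) := by
    intro J s S
    classical
    induction s using Finset.induction_on with
    | empty => simp [hempty]
    | insert j s hj ih =>
      intro hd
      rw [Finset.coe_insert] at hd
      rw [Finset.sum_insert hj, Finset.set_biUnion_insert, hadd, ih (hd.subset (Set.subset_insert _ _))]
      refine Set.disjoint_iUnion₂_right.2 fun i hi => hd (by simp) (by simp [hi]) ?_
      rintro rfl
      exact hj hi
  obtain ⟨f, hf, hfK⟩ := (Finset.all_card_le_biUnion_card_iff_exists_injective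
    fun p : G × Bool => K * {p.1}).1 fun s => by
      have h₁ : s.card ≤ (s.image Prod.fst ×ˢ (Finset.univ : Finset Bool)).card :=
        Finset.card_le_card fun p hp => 
          Finset.mem_product.2 ⟨Finset.mem_image_of_mem _ hp, Finset.mem_univ _⟩
      have h₂ : (s.biUnion fun p => K * {p.1}) = K * s.image Prod.fst := by
        ext x
        simp only [Finset.mem_biUnion, Finset.mem_mul, Finset.mem_singleton, Finset.mem_image]
        constructor
        · rintro ⟨p, hp, k, hk, _, rfl, rfl⟩
          exact ⟨k, hk, p.1, ⟨p, hp, rfl⟩, rfl⟩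
        · rintro ⟨k, hk, _, ⟨p, hp, rfl⟩, rfl⟩
          exact ⟨p, hp, k, hk, p.1, rfl, rfl⟩
      have h₃ := hK (s.image Prod.fst)
      rw [Finset.card_product, Finset.card_univ, Fintype.card_bool] at h₁
      rw [h₂]
      omega
  let S : G × Bool → Set G := fun j => {x | f (x, j.2) = j.1 * x}
  -- For fixed `b` the pieces partition `G`; all their translates, over both values of `b`, are
  -- disjoint because `f` is injective.
  have hS : ∀ b, ∑ k ∈ K, μ (S (k, b)) = 1 := fun b => by
    rw [← hsum K (fun k => S (k, b)), ← huniv]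
    · congr 1
      refine Set.eq_univ_of_forall fun x => ?_
      obtain ⟨k, hk, _, hx, h⟩ := Finset.mem_mul.1 (hfK (x, b))
      rw [Finset.mem_singleton] at hx
      subst hx
      exact Set.mem_iUnion₂.2 ⟨k, hk, h.symm⟩
    · refine fun k _ k' _ hkk => Set.disjoint_left.2 fun x hx hx' => hkk ?_
      exact mul_right_cancel ((Eq.symm hx).trans hx')
  have htotal := hsum (K ×ˢ (Finset.univ : Finset Bool)) (fun j => (fun x => j.1 * x) '' S j) (by
    rintro ⟨k, b⟩ - ⟨k', b'⟩ - hne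
    refine Set.disjoint_left.2 ?_
    rintro _ ⟨x, hx, rfl⟩ ⟨x', hx', h⟩
    have h' : f (x, b) = f (x', b') := by
      change f (x, b) = k * x at hx
      change f (x', b') = k' * x' at hx'
      rw [hx, hx']; exact h.symm
    obtain ⟨rfl, rfl⟩ := Prod.mk.inj (hf h')
    exact hne (Prod.ext (mul_right_cancel h).symm rfl))
  rw [Finset.sum_product_right] at htotal
  simp only [hinv, hS] at htotal
  have hmono : ∀ s : Set G, μ s ≤ 1 := fun s => by
    have := hadd s sᶜ disjoint_compl_right
    rw [Set.union_compl_self, huniv] at this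
    linarith [hpos sᶜ]
  have := hmono (⋃ j ∈ K ×ˢ (Finset.univ : Finset Bool), (fun x => j.1 * x) '' S j)
  rw [htotal] at this
  norm_num at this

/-- An amenable group has Følner sets. -/
theorem IsAmenable.exists_foelner [DecidableEq G] (hG : IsAmenable G) (K : Finset G)
    {ε : ℝ} (hε : 0 < ε) :
    ∃ F : Finset G, F.Nonempty ∧ ∀ g ∈ K, ({x ∈ F | g * x ∉ F}.card : ℝ) ≤ ε * F.card := by
  by_contra! hK
  have hgrow : ∀ F : Finset G, (1 + ε) * F.card ≤ (insert 1 K * F).card := fun F => by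
    rcases F.eq_empty_or_nonempty with rfl | hF
    · simp
    obtain ⟨g, hg, h⟩ := hK F hF
    have hsub : F ∪ {x ∈ F | g * x ∉ F}.image (g * ·) ⊆ insert 1 K * F := by
      refine Finset.union_subset (fun x hx => ?_) fun x hx => ?_
      · exact Finset.mem_mul.2 ⟨1, by simp, x, hx, one_mul x⟩
      · obtain ⟨y, hy, rfl⟩ := Finset.mem_image.1 hx
        exact Finset.mul_mem_mul (by simp [hg]) (Finset.mem_filter.1 hy).1
    have hcard := Finset.card_le_card hsub
    rw [Finset.card_union_of_disjoint, Finset.card_image_of_injective _ (mul_right_injective g)]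
      at hcard
    · have : (F.card : ℝ) + ({x ∈ F | g * x ∉ F}.card : ℝ) ≤ (insert 1 K * F).card := by
        exact_mod_cast hcard
      linarith
    · refine Finset.disjoint_right.2 fun x hx => ?_
      obtain ⟨y, hy, rfl⟩ := Finset.mem_image.1 hx
      exact (Finset.mem_filter.1 hy).2
  -- Without Følner sets growth is uniform, so some power of `insert 1 K` doubles every finite set.
  have hpow : ∀ (n : ℕ) (F : Finset G), (1 + ε) ^ n * F.card ≤ ((insert 1 K) ^ n * F).card := by
    intro n
    induction n with
    | zero => simp
    | succ n ih =>
      intro F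
      have h₁ := hgrow ((insert 1 K) ^ n * F)
      have h₂ := mul_le_mul_of_nonneg_left (ih F) (by positivity : 0 ≤ 1 + ε)
      rw [← mul_assoc, ← pow_succ'] at h₁ h₂
      exact h₂.trans h₁
  obtain ⟨n, hn⟩ := pow_unbounded_of_one_lt 2 (by linarith : 1 < 1 + ε)
  obtain ⟨F, hF⟩ := hG.not_doubling ((insert 1 K) ^ n)
  have h₁ : (((insert 1 K) ^ n * F).card : ℝ) < 2 * F.card := by exact_mod_cast hF
  have h₂ := hpow n F
  have h₃ := mul_le_mul_of_nonneg_right hn.le (F.card.cast_nonneg (α := ℝ))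
  linarith

end Foelner

theorem exists_isLabelledApprox_of_isAmenable.{u, v} {M : Type u} [Monoid M] {G : Type v} [Group G]
    (ι : G →* M) (hG : IsAmenable G) (K : Finset G) (T : Finset M) {ε : ℝ} (hε : 0 < ε) :
    ∃ (A : Type v) (_ : Finite A) (_ : Nonempty A) (φ : G → A → A) (l : A → G),
      IsLabelledApprox ι K T ε φ l := by
  classical
  -- Products are included because multiplicativity needs both `k * x` and `g * k * x` in `F`; each
  -- exclusion costs `ε / 2`.
  obtain ⟨F, hF, hFK⟩ := IsAmenable.exists_foelner hG
    (K ∪ (K ×ˢ K).image fun p => p.1 * p.2) (half_pos hε)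
  have : Nonempty F := hF.to_subtype
  let φ : G → F → F := fun g x => if h : g * x ∈ F then ⟨g * x, h⟩ else x
  have hφ : ∀ (g : G) (x : F), g * (x : G) ∈ F → (φ g x : G) = g * x := fun g x h => by
    simp only [φ, dif_pos h]
  have hbad : ∀ g ∈ K ∪ (K ×ˢ K).image (fun p => p.1 * p.2),
      proportion (fun x : F => g * x ∉ F) ≤ ε / 2 := fun g hg => by
    have hcard : Nat.card {x : F // g * x ∉ F} = {x ∈ F | g * x ∉ F}.card := by
      rw [← Nat.card_eq_finsetCard]
      exact Nat.card_congr
        { toFun := fun x => ⟨x.1, Finset.mem_filter.2 ⟨x.1.2, x.2⟩⟩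
          invFun := fun x => ⟨⟨x.1, (Finset.mem_filter.1 x.2).1⟩, (Finset.mem_filter.1 x.2).2⟩
          left_inv := fun _ => rfl
          right_inv := fun _ => rfl }
    unfold proportion
    rw [hcard, Nat.card_eq_fintype_card, Fintype.card_coe, div_le_iff₀]
    · exact hFK g hg
    · exact_mod_cast hF.card_pos
  have hmem : ∀ g ∈ K, g ∈ K ∪ (K ×ˢ K).image (fun p => p.1 * p.2) := fun g hg =>
    Finset.mem_union_left _ hg
  have key : ∀ (p : F → Prop), ∀ g ∈ K ∪ (K ×ˢ K).image (fun p => p.1 * p.2),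
      ∀ k ∈ K ∪ (K ×ˢ K).image (fun p => p.1 * p.2),
      (∀ x : F, g * x ∈ F → k * x ∈ F → ¬ p x) → proportion p ≤ ε := by
    intro p g hg k hk hp
    have h₁ := proportion_or_le (fun x : F => g * x ∉ F) (fun x : F => k * x ∉ F)
    have h₂ : proportion p ≤ proportion (fun x : F => g * x ∉ F ∨ k * x ∉ F) :=
      proportion_mono fun x hx => by
        by_contra! h
        exact hp x h.1 h.2 hx
    linarith [hbad g hg, hbad k hk]
  refine ⟨F, inferInstance, inferInstance, φ, Subtype.val, ⟨fun x => ?_, ?_, ?_, ?_⟩⟩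
  · exact Subtype.ext (by rw [hφ _ _ (by simp), one_mul])
  · intro g hg k hk
    refine key _ k (hmem k hk) (g * k) (Finset.mem_union_right _
      (Finset.mem_image.2 ⟨(g, k), by simp [hg, hk], rfl⟩)) fun x hx hx' h => h (Subtype.ext ?_)
    have : g * (φ k x : G) = g * k * x := by rw [hφ k x hx, mul_assoc]
    rw [hφ g _ (this ▸ hx'), hφ _ _ hx', this]
  · intro g hg k hk hgk
    refine key _ g (hmem g hg) k (hmem k hk) fun x hx hx' h => hgk ?_
    have := congrArg Subtype.val h
    rw [hφ _ _ hx, hφ _ _ hx'] at this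
    exact mul_right_cancel this
  · intro g hg t _
    refine key _ g (hmem g hg) g (hmem g hg) fun x hx _ h => h ?_
    rw [hφ _ _ hx, map_mul, mul_assoc]

/-! ### Green's relations and the group of the identity. -/

/-- Writing `1 = p * (a * b) * q` exhibits `1` in the two-sided ideals of both `a` and `b`. Hence
the complement of this class is an ideal. -/
theorem mem_of_mul_mem_greenJ_one {M : Type*} [Monoid M] {a b : M} (h : GreenJ (a * b) 1) :
    GreenJ a 1 ∧ GreenJ b 1 := by
  have h1 : (1 : M) ∈ {z : M | ∃ p q : M, z = p * (a * b) * q} := by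
    rw [h]; exact ⟨1, 1, by simp⟩
  obtain ⟨p, q, hpq⟩ := h1
  have key : ∀ x c d : M, 1 = c * x * d → GreenJ x 1 := fun x c d hx => by
    refine Set.Subset.antisymm ?_ ?_
    · rintro _ ⟨p, q, rfl⟩
      exact ⟨p * x, q, by simp⟩
    · rintro _ ⟨p, q, rfl⟩
      exact ⟨p * c, d * q, by rw [hx]; simp only [mul_assoc]⟩
  exact ⟨key a p (b * q) (by simpa only [mul_assoc] using hpq),
    key b (p * a) q (by simpa only [mul_assoc] using hpq)⟩

theorem greenR_mul_unit {M : Type*} [Monoid M] {G : Type*} [Group G] (ι : G →* M) (x : M) (g : G) :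
    GreenR (x * ι g) x := by
  refine Set.Subset.antisymm ?_ ?_
  · rintro _ ⟨a, rfl⟩
    exact ⟨ι g * a, mul_assoc _ _ _⟩
  · rintro _ ⟨a, rfl⟩
    refine ⟨ι g⁻¹ * a, ?_⟩
    rw [mul_assoc, ← mul_assoc (ι g), ← map_mul, mul_inv_cancel, map_one, one_mul]

end SoficMonoids

theorem corollary3p2 {M : Type*} [Monoid M] {G : Type*} [Group G]
    -- the `𝒥`-class of the identity of `M` is the group `G`, embedded by `ι`
    (ι : G →* M) (hι : Function.Injective ι)
    (hJ : {x : M | SoficMonoids.GreenJ x 1} = Set.range ι)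
    (hG : SoficMonoids.IsSoficGroup G)
    (h : SoficMonoids.IsAmenable G ∨
      {x : M | x ∉ Set.range ι}.Finite ∨
      (∀ x : M, x ∉ Set.range ι → {y : M | SoficMonoids.GreenR y x}.Finite)) :
    SoficMonoids.IsSofic M := by
  have hideal : ∀ a b : M, a * b ∈ Set.range ι → a ∈ Set.range ι ∧ b ∈ Set.range ι := by
    rw [← hJ]
    exact fun a b hab => SoficMonoids.mem_of_mul_mem_greenJ_one hab
  rcases h with h | h
  · exact SoficMonoids.isSofic_of_isLabelledApprox ι hι hideal fun K T ε hε _ =>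
      SoficMonoids.exists_isLabelledApprox_of_isAmenable ι h K T hε
  · refine SoficMonoids.isSofic_of_isLabelledApprox ι hι hideal fun K T ε hε hT =>
      SoficMonoids.exists_isLabelledApprox_of_finite_orbits ι hG K T hε fun t ht => ?_
    rcases h with h | h
    · refine h.subset ?_
      rintro _ ⟨g, rfl⟩ hg
      exact hT t ht (hideal _ _ hg).1
    · refine (h t (hT t ht)).subset ?_
      rintro _ ⟨g, rfl⟩
      exact SoficMonoids.greenR_mul_unit ι t g
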